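/- **Lemma 2.2.** Let $\lambda,\mu\in\mathbb R$ with $\mu>0$ and $3\lambda+2\mu>0$, put $\nu=\frac{\lambda}{2(\lambda+\mu)}$, and let $D_I\varepsilon=\lambda\,\mathrm{trace}(\varepsilon)I+2\mu\varepsilon$. Let $b=(b_1,0,b_3)\in\mathbb R^3$, $D_1=\frac{\mu b_1}{2\pi(1-\nu)}$, $D_2=\frac{\mu b_3}{2\pi}$, $r^2=x_1^2+x_2^2$ and $\overline\Sigma=\{x\in\mathbb R^3: x_1\ge 0,\ x_2=0\}$. Define $u:\mathbb R^3\setminus\overline\Sigma\to\mathbb R^3$ by $$u_1=\frac{b_1}{2\pi}\Big(\theta+\frac{1}{2(1-\nu)}\frac{x_1x_2}{r^2}\Big),\quad u_2=-\frac{b_1}{4\pi(1-\nu)}\Big((1-2\nu)\log r+\frac{x_1^2}{r^2}\Big),\quad u_3=\frac{b_3}{2\pi}\theta,$$ where $\theta(x)\in(0,2\pi)$ is the polar angle of $(x_1,x_2)$ (the branch of $\arctan\frac{x_2}{x_1}$ that is continuous off $\overline\Sigma$), and define the symmetric matrix field $T$ by $$T_{11}=-D_1\frac{x_2(3x_1^2+x_2^2)}{r^4},\quad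 T_{12}=D_1\frac{x_1(x_1^2-x_2^2)}{r^4},\quad T_{13}=-D_2\frac{x_2}{r^2},$$ $$T_{22}=D_1\frac{x_2(x_1^2-x_2^2)}{r^4},\quad T_{23}=D_2\frac{x_1}{r^2},\quad T_{33}=-2\nu D_1\frac{x_2}{r^2}.$$ Then $u$ is differentiable on $\mathbb R^3\setminus\overline\Sigma$, and $\nabla u=(\partial_ju_i)_{ij}$ and $T$ are locally integrable on $\mathbb R^3$. The matrix-valued distributions $\langle\tilde h_e,\tilde\varphi\rangle=\int_{\mathbb R^3}\nabla u:\tilde\varphi\,dx$ and $\langle T,\tilde\varphi\rangle=\int_{\mathbb R^3}T:\tilde\varphi\,dx$, $\tilde\varphi\in C_0^\infty(\mathbb R^3,\mathbb R^{3\times3})$, satisfy $$-\operatorname{div}T=0,\qquad T=D_I\,\varepsilon(\tilde h_e),\qquad \operatorname{rot}\tilde h_e=\hat b\otimes\rho_\ell .$$ Here $A:B=\sum_{i,j}A_{ij}B_{ij}$, $\varepsilon(A)=\frac12(A+A^T)$, and $\hat b\otimes\rho_\ell$ is the matrix-valued measure of the $x_3$-axis $\ell$ with tangent $\tau=e_3$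 and Burgers vector $b$, $\langle\hat b\otimes\rho_\ell,\tilde\varphi\rangle=\int_\ell (b\otimes\tau):\tilde\varphi\,ds$ with $(b\otimes\tau)_{ij}=b_i\tau_j$. The operators are defined by $\langle\operatorname{div}w,\varphi\rangle=-\langle w,\nabla\varphi\rangle$ for $\varphi\in C_0^\infty(\mathbb R^3,\mathbb R^3)$, $\langle\varepsilon(w),\tilde\varphi\rangle=\langle w,\varepsilon(\tilde\varphi)\rangle$ and $\langle\operatorname{rot}w,\tilde\varphi\rangle=\langle w,\operatorname{rot}\tilde\varphi\rangle$, where $\operatorname{rot}$ of a matrix field is the usual curl taken row by row. -/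

import Mathlib

open MeasureTheory TopologicalSpace
open scoped Distributions

noncomputable section

namespace Dislocation

/-- Points and vectors of three-dimensional Euclidean space. The coordinates `x₁, x₂, x₃` are
`x 0, x 1, x 2`. -/
abbrev E3 : Type := EuclideanSpace ℝ (Fin 3)

/-- Real 3×3 matrices as functions of the row and the column index, with the product topology
(the norm is the entrywise maximum; only its topology matters here). -/
abbrev M3 : Type := Fin 3 → Fin 3 → ℝ

/-- The standard basis vectors. -/
def e (j : Fin 3) : E3 := EuclideanSpace.single j 1

/-- The tensor product `(a ⊗ b)ᵢⱼ = aᵢ bⱼ`. -/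
def tensor (a b : E3) : M3 := fun i j => a i * b j

/-- The scalar product of matrices `A : B = ∑ᵢⱼ Aᵢⱼ Bᵢⱼ`. -/
def dotdot (A B : M3) : ℝ := ∑ i, ∑ j, A i j * B i j

/-- `dotdot` as a continuous bilinear map. -/
def dotdotCLM : M3 →L[ℝ] M3 →L[ℝ] ℝ :=
  (LinearMap.mk₂ ℝ dotdot
    (fun A A' B => by simp [dotdot, add_mul, Finset.sum_add_distrib])
    (fun c A B => by simp [dotdot, Finset.mul_sum, mul_assoc])
    (fun A B B' => by simp [dotdot, mul_add, Finset.sum_add_distrib])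
    (fun c A B => by simp [dotdot, Finset.mul_sum, mul_left_comm])).toContinuousBilinearMap

theorem dotdotCLM_apply (A B : M3) : dotdotCLM A B = dotdot A B := rfl

/-! ### Pointwise linear operations -/

/-- The matrix `(∂ⱼ fᵢ)ᵢⱼ` of a derivative `A = Df(x)` of a vector field. -/
def gradMatrix : (E3 →L[ℝ] E3) →L[ℝ] M3 :=
  LinearMap.toContinuousLinearMap
    { toFun := fun A => fun i j => A (e j) i
      map_add' := fun A B => by ext; simp
      map_smul' := fun c A => by ext; simp }

/-- The row-wise rotation of a matrix field with derivative `A = DF(x)`. With indices modulo 3 its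
entries are `(rot F)ᵢⱼ = ∂ⱼ₊₁ Fᵢ,ⱼ₊₂ - ∂ⱼ₊₂ Fᵢ,ⱼ₊₁`. -/
def rotMatrix : (E3 →L[ℝ] M3) →L[ℝ] M3 :=
  LinearMap.toContinuousLinearMap
    { toFun := fun A => fun i j =>
        A (e (j + 1)) i (j + 2) - A (e (j + 2)) i (j + 1)
      map_add' := fun A B => by ext; simp; ring
      map_smul' := fun c A => by ext; simp; ring }

/-- The symmetric part `ε(A) = (A + Aᵀ) / 2`. -/
def symPart : M3 →L[ℝ] M3 :=
  LinearMap.toContinuousLinearMap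
    { toFun := fun A => (1 / 2 : ℝ) • (A + fun i j => A j i)
      map_add' := fun A B => by ext; simp; ring
      map_smul' := fun c A => by ext; simp; ring }

/-- The trace of a matrix. -/
def traceCLM : M3 →L[ℝ] ℝ :=
  LinearMap.toContinuousLinearMap
    { toFun := fun A => ∑ i, A i i
      map_add' := fun A B => by simp [Finset.sum_add_distrib]
      map_smul' := fun c A => by simp [Finset.mul_sum] }

/-- `s ↦ s I`, with `I` the identity matrix. -/
def scalarMatrix : ℝ →L[ℝ] M3 :=
  ContinuousLinearMap.toSpanSingleton ℝ (fun i j => if i = j then 1 else 0)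

/-! ### Distributions on `ℝ³` with values in scalars, vectors and matrices

They are the continuous linear functionals on the spaces `C₀^∞` of scalar-, vector- and
matrix-valued test functions with their canonical LF topology. -/

abbrev ScalarDistribution : Type := 𝓓((⊤ : Opens E3), ℝ) →L[ℝ] ℝ

abbrev VectorDistribution : Type := 𝓓((⊤ : Opens E3), E3) →L[ℝ] ℝ

abbrev TensorDistribution : Type := 𝓓((⊤ : Opens E3), M3) →L[ℝ] ℝ

/-- The gradient `(∂ⱼ φᵢ)ᵢⱼ` of vector-valued test functions. -/
def testGrad : 𝓓((⊤ : Opens E3), E3) →L[ℝ] 𝓓((⊤ : Opens E3), M3) :=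
  (TestFunction.postcompCLM gradMatrix).comp (TestFunction.fderivCLM ℝ ⊤ ⊤)

/-- The row-wise rotation of matrix-valued test functions. -/
def testRot : 𝓓((⊤ : Opens E3), M3) →L[ℝ] 𝓓((⊤ : Opens E3), M3) :=
  (TestFunction.postcompCLM rotMatrix).comp (TestFunction.fderivCLM ℝ ⊤ ⊤)

theorem testGrad_apply (φ : 𝓓((⊤ : Opens E3), E3)) (x : E3) (i j : Fin 3) :
    testGrad φ x i j = fderiv ℝ φ x (e j) i := by
  simp [testGrad, gradMatrix]

theorem testRot_apply (φ : 𝓓((⊤ : Opens E3), M3)) (x : E3) (i j : Fin 3) :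
    testRot φ x i j =
      fderiv ℝ φ x (e (j + 1)) i (j + 2) - fderiv ℝ φ x (e (j + 2)) i (j + 1) := by
  simp [testRot, rotMatrix]

/-- `⟨div w, φ⟩ = -⟨w, ∇φ⟩`. -/
def distDiv (w : TensorDistribution) : VectorDistribution := -(w.comp testGrad)

/-- `⟨rot w, φ⟩ = ⟨w, rot φ⟩`. -/
def distRot (w : TensorDistribution) : TensorDistribution := w.comp testRot

/-- `⟨ε(w), φ⟩ = ⟨w, ε(φ)⟩`. -/
def distSym (w : TensorDistribution) : TensorDistribution :=
  w.comp (TestFunction.postcompCLM symPart)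

/-- `⟨trace w, ψ⟩ = ⟨w, ψ I⟩`. -/
def distTrace (w : TensorDistribution) : ScalarDistribution :=
  w.comp (TestFunction.postcompCLM scalarMatrix)

/-- `⟨s I, φ⟩ = ⟨s, trace φ⟩`. -/
def distScalar (s : ScalarDistribution) : TensorDistribution :=
  s.comp (TestFunction.postcompCLM traceCLM)

/-- The isotropic elasticity tensor `D_I w = lam (trace w) I + 2 mu w`, on distributions. -/
def distElasticity (lam mu : ℝ) (w : TensorDistribution) : TensorDistribution :=
  lam • distScalar (distTrace w) + (2 * mu) • w

/-- The distribution `φ ↦ ∫ F : φ dm` of a matrix field `F` that is locally integrable for the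
measure `m` (and `0` for other `F`). -/
def distOf (m : Measure E3) (F : E3 → M3) : TensorDistribution :=
  TestFunction.integralAgainstBilinCLM dotdotCLM m F

theorem distOf_apply {m : Measure E3} {F : E3 → M3} (hF : LocallyIntegrable F m)
    (φ : 𝓓((⊤ : Opens E3), M3)) : distOf m F φ = ∫ x, dotdot (F x) (φ x) ∂m := by
  have h : LocallyIntegrableOn F ((⊤ : Opens E3) : Set E3) m := hF.locallyIntegrableOn _
  rw [distOf, TestFunction.integralAgainstBilinCLM_eq_integral h]
  simp only [dotdotCLM_apply, dotdot, mul_comm]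

/-! ### The dislocation measure of the `x₃`-axis -/

/-- The arc length measure of the `x₃`-axis: the image of Lebesgue measure on `ℝ` under the arc
length parametrization `s ↦ s e₃`. -/
def axisMeasure : Measure E3 := Measure.map (fun s : ℝ => s • e 2) volume

theorem isClosedEmbedding_axis : Topology.IsClosedEmbedding (fun s : ℝ => s • e 2) := by
  refine Isometry.isClosedEmbedding (Isometry.of_dist_eq fun a b => ?_)
  rw [dist_eq_norm, ← sub_smul, norm_smul, dist_eq_norm]
  simp [e]

/-- The matrix-valued measure `b̂ ⊗ ρ_ℓ` of the `x₃`-axis `ℓ` with tangent `τ = e₃` and Burgers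
vector `b`, as a distribution: its density with respect to arc length is the constant Nye tensor
`b ⊗ τ`. -/
def nyeMeasure (b : E3) : TensorDistribution := distOf axisMeasure fun _ => tensor b (e 2)

theorem nyeMeasure_apply (b : E3) (φ : 𝓓((⊤ : Opens E3), M3)) :
    nyeMeasure b φ = ∫ s : ℝ, dotdot (tensor b (e 2)) (φ (s • e 2)) := by
  have hfin : IsLocallyFiniteMeasure axisMeasure := by
    have : IsFiniteMeasureOnCompacts axisMeasure := by
      refine ⟨fun K hK => ?_⟩
      rw [axisMeasure, isClosedEmbedding_axis.measurableEmbedding.map_apply]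
      exact (isClosedEmbedding_axis.isCompact_preimage hK).measure_lt_top
    infer_instance
  rw [nyeMeasure, distOf_apply (locallyIntegrable_const _), axisMeasure,
    isClosedEmbedding_axis.measurableEmbedding.integral_map]

/-! ### The explicit solution for a straight dislocation line -/

/-- The closure of the half plane `Σ = {x₁ > 0, x₂ = 0}`, that is `Σ` together with the
`x₃`-axis. -/
def closedHalfPlane : Set E3 := {x | 0 ≤ x 0 ∧ x 1 = 0}

/-- The branch of `arctan (x₂ / x₁)` that is continuous off the closed half plane: the polar angle
of `(x₁, x₂)` with values in `(0, 2π)` there. It tends to `0` from `x₂ > 0` and to `2π` from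
`x₂ < 0` at `Σ`. -/
def angle (x : E3) : ℝ := Real.pi + Complex.arg (-(⟨x 0, x 1⟩ : ℂ))

/-- The distance from the `x₃`-axis. -/
def rad (x : E3) : ℝ := Real.sqrt (x 0 ^ 2 + x 1 ^ 2)

def poisson (lam mu : ℝ) : ℝ := lam / (2 * (lam + mu))

/-- The displacement field of the dislocation line with Burgers vector `(b₁, 0, b₃)`. -/
def displacement (lam mu b₁ b₃ : ℝ) (x : E3) : E3 :=
  let nu := poisson lam mu
  !₂[b₁ / (2 * Real.pi) * (angle x + 1 / (2 * (1 - nu)) * (x 0 * x 1 / rad x ^ 2)),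
    -(b₁ / (4 * Real.pi * (1 - nu))) * ((1 - 2 * nu) * Real.log (rad x) + x 0 ^ 2 / rad x ^ 2),
    b₃ / (2 * Real.pi) * angle x]

/-- The gradient `(∂ⱼ uᵢ)ᵢⱼ` of the displacement field; only its values off the closed half plane,
which has measure zero, matter. -/
def displacementGrad (lam mu b₁ b₃ : ℝ) (x : E3) : M3 :=
  gradMatrix (fderiv ℝ (displacement lam mu b₁ b₃) x)

/-- The stress field of the dislocation line with Burgers vector `(b₁, 0, b₃)`. -/
def stress (lam mu b₁ b₃ : ℝ) (x : E3) : M3 :=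
  let nu := poisson lam mu
  let D₁ := mu * b₁ / (2 * Real.pi * (1 - nu))
  let D₂ := mu * b₃ / (2 * Real.pi)
  let T₁₁ := -D₁ * (x 1 * (3 * x 0 ^ 2 + x 1 ^ 2) / rad x ^ 4)
  let T₁₂ := D₁ * (x 0 * (x 0 ^ 2 - x 1 ^ 2) / rad x ^ 4)
  let T₁₃ := -D₂ * (x 1 / rad x ^ 2)
  let T₂₂ := D₁ * (x 1 * (x 0 ^ 2 - x 1 ^ 2) / rad x ^ 4)
  let T₂₃ := D₂ * (x 0 / rad x ^ 2)
  let T₃₃ := -2 * nu * D₁ * (x 1 / rad x ^ 2)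
  ![![T₁₁, T₁₂, T₁₃],
    ![T₁₂, T₂₂, T₂₃],
    ![T₁₃, T₂₃, T₃₃]]

end Dislocation

end

/-! Off the closed half plane each row of ∇u is a linear combination of the gradients of four
functions: log r, x₁²/r², x₁x₂/r² and θ. These gradients are homogeneous of degree -1 in (x₁, x₂),
hence bounded by a multiple of 1/r, which is locally integrable on ℝ³. The half plane is a null set,
so the jump of θ across it does not enter ∇u as a locally integrable field.

The first three functions are single-valued and locally integrable (`IsAxisPotential`). Almost every
line parallel to a coordinate axis misses the x₃-axis, so Fubini and integration by parts on lines
show that their pointwise gradients are weak gradients (`IsAxisPotential.integral_grad_mul`). Second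
derivatives of test functions commute, so these gradients are curl free as distributions. The angle
is different: ∇θ is ∇ log r turned by a right angle, so its curl is e₃ times the distributional
Laplacian of log r, which is 2π times arc length on the axis. Polar coordinates give this value
(`integral_gradLogRad_mul`): the Jacobian r cancels the singularity, and each ray contributes minus
the value of the test function on the axis. The factors b₁/2π and b₃/2π of θ then produce exactly
the Burgers vector (`hasCirculation_gradDisplacement`).

Hooke's law is a pointwise algebraic identity (`stress_eq_hooke`). For equilibrium, the first two
entries of each row of T have the form (∂₂ψ, -∂₁ψ) with ψ an axis potential, and the third is a
multiple of a derivative of log r, which does not depend on x₃ (`integral_div_eq_zero`,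
`integral_stress_row`). -/

noncomputable section

namespace Dislocation

/-! ### Distance from the axis and linear forms -/

/-- The square of the distance from the `x₃`-axis. -/
def radSq (x : E3) : ℝ := x 0 ^ 2 + x 1 ^ 2

theorem rad_sq (x : E3) : rad x ^ 2 = radSq x := Real.sq_sqrt (by positivity)

theorem rad_pow_four (x : E3) : rad x ^ 4 = radSq x ^ 2 := by
  rw [← rad_sq]; ring

theorem radSq_nonneg (x : E3) : 0 ≤ radSq x := by unfold radSq; positivity

theorem rad_pos {x : E3} (hx : radSq x ≠ 0) : 0 < rad x :=
  Real.sqrt_pos.2 (lt_of_le_of_ne (radSq_nonneg x) hx.symm)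

/-- The linear form with coefficients `p`. -/
def covector (p : Fin 3 → ℝ) : E3 →L[ℝ] ℝ :=
  ∑ j, p j • EuclideanSpace.proj j

theorem covector_apply (p : Fin 3 → ℝ) (v : E3) : covector p v = ∑ j, p j * v j := by
  simp [covector]

theorem covector_e (p : Fin 3 → ℝ) (j : Fin 3) : covector p (e j) = p j := by
  simp [covector_apply, e]

theorem covector_smul (c : ℝ) (p : Fin 3 → ℝ) : covector (c • p) = c • covector p := by
  ext v; simp [covector_apply, Finset.mul_sum, mul_assoc]

theorem covector_add (p q : Fin 3 → ℝ) : covector (p + q) = covector p + covector q := by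
  ext v; simp [covector_apply, Finset.sum_add_distrib, add_mul]

/-! ### Local integrability -/

theorem ae_coord_ne_zero (j : Fin 3) : ∀ᵐ x : E3, x j ≠ 0 := by
  have h : ∀ᵐ y : Fin 3 → ℝ, y j ≠ 0 := Measure.ae_eval_ne (fun _ => volume) j 0
  exact (PiLp.volume_preserving_ofLp (Fin 3)).quasiMeasurePreserving.ae h

theorem ae_radSq_ne_zero : ∀ᵐ x : E3, radSq x ≠ 0 := by
  filter_upwards [ae_coord_ne_zero 0] with x hx
  have := sq_pos_of_ne_zero hx
  unfold radSq
  positivity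

theorem integrableOn_abs_rpow_neg_half (R : ℝ) :
    IntegrableOn (fun t : ℝ => |t| ^ (-(1 / 2) : ℝ)) (Set.Icc (-R) R) := by
  -- `max R 0` appears because the sign of `R` is not known.
  have h : IntegrableOn (fun t : ℝ => t ^ (-(1 / 2) : ℝ)) (Set.Ioc 0 (max R 0)) := by
    have := (intervalIntegral.intervalIntegrable_rpow' (a := 0) (b := max R 0)
      (r := -(1 / 2)) (by norm_num)).1
    simpa using this
  have h1 : IntegrableOn (fun t : ℝ => |t| ^ (-(1 / 2) : ℝ)) (Set.Ioc 0 (max R 0)) :=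
    h.congr_fun (fun t ht => by simp [abs_of_pos ht.1]) measurableSet_Ioc
  have h2 : IntegrableOn (fun t : ℝ => |t| ^ (-(1 / 2) : ℝ)) (Set.Ico (-(max R 0)) 0) := by
    have := h1.comp_neg
    simpa using this
  have h3 : IntegrableOn (fun t : ℝ => |t| ^ (-(1 / 2) : ℝ)) {0} := by
    simp
  refine ((h1.union h2).union h3).mono_set fun t ht => ?_
  rcases lt_trichotomy t 0 with h | h | h
  · exact Or.inl (Or.inr ⟨(neg_le_neg (le_max_left _ _)).trans ht.1, h⟩)
  · exact Or.inr h
  · exact Or.inl (Or.inl ⟨h, ht.2.trans (le_max_left _ _)⟩)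

/-- On a cube containing the given compact set this is a product of integrable functions of one
variable; the third factor is the indicator of an interval. It serves as a majorant of 1/r that
avoids polar coordinates. -/
theorem locallyIntegrable_abs_rpow_mul :
    LocallyIntegrable (fun x : E3 => |x 0| ^ (-(1 / 2) : ℝ) * |x 1| ^ (-(1 / 2) : ℝ)) := by
  rw [locallyIntegrable_iff]
  intro K hK
  obtain ⟨R, hR⟩ := hK.isBounded.subset_closedBall 0
  let I : Set ℝ := Set.Icc (-R) R
  let g : Fin 3 → ℝ → ℝ := ![I.indicator fun t => |t| ^ (-(1 / 2) : ℝ),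
    I.indicator fun t => |t| ^ (-(1 / 2) : ℝ), I.indicator fun _ => 1]
  have hg : ∀ i, Integrable (g i) := by
    have hI : MeasurableSet I := measurableSet_Icc
    have h1 := (integrable_indicator_iff hI).2 (integrableOn_abs_rpow_neg_half R)
    have h2 : Integrable (I.indicator fun _ : ℝ => (1 : ℝ)) :=
      (integrable_indicator_iff hI).2 (integrableOn_const (by simp [I]))
    intro i
    fin_cases i
    exacts [h1, h1, h2]
  have hprod : Integrable (fun y : Fin 3 → ℝ => ∏ i, g i (y i)) := Integrable.fintype_prod hg
  have hE : Integrable (fun x : E3 => ∏ i, g i (x i)) :=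
    (PiLp.volume_preserving_ofLp (Fin 3)).integrable_comp_of_integrable hprod
  refine hE.integrableOn.congr_fun (s := K) (fun x hx => ?_) hK.measurableSet
  have hmem : ∀ i, x i ∈ I := fun i => by
    have h1 : ‖x‖ ≤ R := by simpa using hR hx
    exact abs_le.1 ((PiLp.norm_apply_le x i).trans h1)
  simp [Fin.prod_univ_three, g, hmem]

/-- Since |x₁||x₂| ≤ r², one has 1/r ≤ |x₁|^(-1/2) |x₂|^(-1/2) off the coordinate planes. -/
theorem locallyIntegrable_inv_rad : LocallyIntegrable (fun x : E3 => (rad x)⁻¹) := by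
  refine locallyIntegrable_abs_rpow_mul.mono ?_ ?_
  · unfold rad
    exact (by fun_prop : Measurable _).aestronglyMeasurable
  · filter_upwards [ae_coord_ne_zero 0, ae_coord_ne_zero 1] with x h0 h1
    have h0' := abs_pos.2 h0
    have h1' := abs_pos.2 h1
    rw [← Real.mul_rpow h0'.le h1'.le, Real.rpow_neg (by positivity), ← Real.sqrt_eq_rpow,
      norm_inv, norm_inv]
    refine inv_anti₀ (norm_pos_iff.2 (by positivity)) ?_
    rw [rad, Real.norm_of_nonneg (Real.sqrt_nonneg _), Real.norm_of_nonneg (Real.sqrt_nonneg _)]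
    refine Real.sqrt_le_sqrt ?_
    rw [← sq_abs (x 0), ← sq_abs (x 1)]
    nlinarith [sq_nonneg (|x 0| - |x 1|)]

/-- One majorant for all cases: 1/r controls gradients and log r near the axis, r controls log r far
away, and 1 controls the bounded potentials. -/
theorem locallyIntegrable_of_abs_le {f : E3 → ℝ} (hf : Measurable f)
    (h : ∀ x, radSq x ≠ 0 → |f x| ≤ 2 * ((rad x)⁻¹ + rad x + 1)) : LocallyIntegrable f := by
  have hr : Continuous rad := by unfold rad; fun_prop
  have hm : LocallyIntegrable (fun x : E3 => (2 : ℝ) * ((rad x)⁻¹ + rad x + 1)) :=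
    ((locallyIntegrable_inv_rad.add hr.locallyIntegrable).add
      (locallyIntegrable_const 1)).smul (2 : ℝ)
  refine hm.mono hf.aestronglyMeasurable ?_
  filter_upwards [ae_radSq_ne_zero] with x hx
  exact (h x hx).trans (le_abs_self _)

/-! ### Potentials with a singularity on the axis -/

/-- `p` is the gradient of `ψ` off the `x₃`-axis, and both are locally integrable on `ℝ³`. -/
structure IsAxisPotential (ψ : E3 → ℝ) (p : E3 → Fin 3 → ℝ) : Prop where
  locallyIntegrable : LocallyIntegrable ψ
  locallyIntegrable_grad : ∀ j, LocallyIntegrable fun x => p x j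
  hasFDerivAt : ∀ x, radSq x ≠ 0 → HasFDerivAt ψ (covector (p x)) x

theorem exists_polar {x : E3} (hx : radSq x ≠ 0) :
    ∃ c s : ℝ, x 0 = rad x * c ∧ x 1 = rad x * s ∧ c ^ 2 + s ^ 2 = 1 := by
  have hr := rad_pos hx
  refine ⟨x 0 / rad x, x 1 / rad x, by field_simp, by field_simp, ?_⟩
  rw [div_pow, div_pow, rad_sq, ← add_div]
  exact div_self hx

/-- A function that is homogeneous of degree `-1` in `(x₁, x₂)` and at most `2` on the unit circle
is locally integrable. -/
theorem locallyIntegrable_of_homogeneous {f : E3 → ℝ} (hf : Measurable f) (q : ℝ → ℝ → ℝ)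
    (hq : ∀ c s : ℝ, c ^ 2 + s ^ 2 = 1 → |q c s| ≤ 2)
    (h : ∀ x c s, radSq x ≠ 0 → x 0 = rad x * c → x 1 = rad x * s → c ^ 2 + s ^ 2 = 1 →
      f x = q c s / rad x) : LocallyIntegrable f := by
  refine locallyIntegrable_of_abs_le hf fun x hx => ?_
  have hr := rad_pos hx
  obtain ⟨c, s, h0, h1, hcs⟩ := exists_polar hx
  rw [h x c s hx h0 h1 hcs, abs_div, abs_of_pos hr, div_eq_mul_inv]
  have := hq c s hcs
  have hi : 0 < (rad x)⁻¹ := by positivity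
  nlinarith

theorem hasFDerivAt_coord (j : Fin 3) (x : E3) :
    HasFDerivAt (fun y : E3 => y j) (EuclideanSpace.proj j : E3 →L[ℝ] ℝ) x :=
  (EuclideanSpace.proj j : E3 →L[ℝ] ℝ).hasFDerivAt

theorem hasFDerivAt_radSq (x : E3) :
    HasFDerivAt radSq (covector ![2 * x 0, 2 * x 1, 0]) x := by
  have := ((hasFDerivAt_coord 0 x).pow 2).add ((hasFDerivAt_coord 1 x).pow 2)
  refine this.congr_fderiv ?_
  ext v
  simp [covector_apply, Fin.sum_univ_three]

theorem hasFDerivAt_inv_radSq {x : E3} (hx : radSq x ≠ 0) :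
    HasFDerivAt (fun y => (radSq y)⁻¹)
      (-(radSq x ^ 2)⁻¹ • covector ![2 * x 0, 2 * x 1, 0]) x :=
  (hasDerivAt_inv hx).comp_hasFDerivAt x (hasFDerivAt_radSq x)

/-! ### The three single-valued potentials -/

/-- `log r`. -/
def logRad (x : E3) : ℝ := Real.log (radSq x) / 2

theorem log_rad (x : E3) : Real.log (rad x) = logRad x := by
  rw [rad, Real.log_sqrt (by positivity)]; rfl

def gradLogRad (x : E3) : Fin 3 → ℝ := ![x 0 / radSq x, x 1 / radSq x, 0]

/-- `x₁² / r²`. -/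
def cosSq (x : E3) : ℝ := x 0 ^ 2 / radSq x

def gradCosSq (x : E3) : Fin 3 → ℝ :=
  ![2 * x 0 * x 1 ^ 2 / radSq x ^ 2, -(2 * x 0 ^ 2 * x 1 / radSq x ^ 2), 0]

/-- `x₁ x₂ / r²`. -/
def cosSin (x : E3) : ℝ := x 0 * x 1 / radSq x

def gradCosSin (x : E3) : Fin 3 → ℝ :=
  ![x 1 * (x 1 ^ 2 - x 0 ^ 2) / radSq x ^ 2, x 0 * (x 0 ^ 2 - x 1 ^ 2) / radSq x ^ 2, 0]

theorem measurable_radSq : Measurable radSq := by unfold radSq; fun_prop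

theorem locallyIntegrable_gradLogRad (j : Fin 3) :
    LocallyIntegrable fun x => gradLogRad x j := by
  have hm := measurable_radSq
  fin_cases j
  · refine locallyIntegrable_of_homogeneous
      (by simp only [gradLogRad]; change Measurable fun x : E3 => x 0 / radSq x; fun_prop)
      (fun c _ => c) (fun c s h => abs_le.2 ⟨by nlinarith, by nlinarith⟩) ?_
    intro x c s hx h0 h1 hcs
    have hr := rad_pos hx
    simp only [gradLogRad, ← rad_sq]
    simp [h0]
    field_simp
  · refine locallyIntegrable_of_homogeneous
      (by simp only [gradLogRad]; change Measurable fun x : E3 => x 1 / radSq x; fun_prop)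
      (fun _ s => s) (fun c s h => abs_le.2 ⟨by nlinarith, by nlinarith⟩) ?_
    intro x c s hx h0 h1 hcs
    have hr := rad_pos hx
    simp only [gradLogRad, ← rad_sq]
    simp [h1]
    field_simp
  · exact locallyIntegrable_const 0

theorem locallyIntegrable_gradCosSq (j : Fin 3) :
    LocallyIntegrable fun x => gradCosSq x j := by
  have hm := measurable_radSq
  fin_cases j
  · refine locallyIntegrable_of_homogeneous
      (by change Measurable fun x : E3 => 2 * x 0 * x 1 ^ 2 / radSq x ^ 2; fun_prop)
      (fun c s => 2 * c * s ^ 2) (fun c s h => abs_le.2 ⟨?_, ?_⟩) ?_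
    · have : s ^ 2 = 1 - c ^ 2 := by linarith
      rw [this]; nlinarith [sq_nonneg (c + 1), sq_nonneg (c - 1), sq_nonneg s, sq_nonneg c]
    · have : s ^ 2 = 1 - c ^ 2 := by linarith
      rw [this]; nlinarith [sq_nonneg (c + 1), sq_nonneg (c - 1), sq_nonneg s, sq_nonneg c]
    intro x c s hx h0 h1 hcs
    have hr := rad_pos hx
    change 2 * x 0 * x 1 ^ 2 / radSq x ^ 2 = _
    rw [h0, h1, ← rad_sq]
    field_simp
  · refine locallyIntegrable_of_homogeneous
      (by change Measurable fun x : E3 => -(2 * x 0 ^ 2 * x 1 / radSq x ^ 2); fun_prop)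
      (fun c s => -(2 * c ^ 2 * s)) (fun c s h => abs_le.2 ⟨?_, ?_⟩) ?_
    · have : c ^ 2 = 1 - s ^ 2 := by linarith
      rw [this]; nlinarith [sq_nonneg (s + 1), sq_nonneg (s - 1), sq_nonneg s, sq_nonneg c]
    · have : c ^ 2 = 1 - s ^ 2 := by linarith
      rw [this]; nlinarith [sq_nonneg (s + 1), sq_nonneg (s - 1), sq_nonneg s, sq_nonneg c]
    intro x c s hx h0 h1 hcs
    have hr := rad_pos hx
    change -(2 * x 0 ^ 2 * x 1 / radSq x ^ 2) = _
    rw [h0, h1, ← rad_sq]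
    field_simp
  · exact locallyIntegrable_const 0

theorem locallyIntegrable_gradCosSin (j : Fin 3) :
    LocallyIntegrable fun x => gradCosSin x j := by
  have hm := measurable_radSq
  fin_cases j
  · refine locallyIntegrable_of_homogeneous
      (by change Measurable fun x : E3 => x 1 * (x 1 ^ 2 - x 0 ^ 2) / radSq x ^ 2; fun_prop)
      (fun c s => s * (s ^ 2 - c ^ 2)) (fun c s h => ?_) ?_
    · have h1 : |s| ≤ 1 := abs_le.2 ⟨by nlinarith, by nlinarith⟩
      have h2 : |s ^ 2 - c ^ 2| ≤ 1 := abs_le.2 ⟨by nlinarith, by nlinarith⟩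
      rw [abs_mul]; nlinarith [abs_nonneg s, abs_nonneg (s ^ 2 - c ^ 2)]
    intro x c s hx h0 h1 hcs
    have hr := rad_pos hx
    change x 1 * (x 1 ^ 2 - x 0 ^ 2) / radSq x ^ 2 = _
    rw [h0, h1, ← rad_sq]
    field_simp
  · refine locallyIntegrable_of_homogeneous
      (by change Measurable fun x : E3 => x 0 * (x 0 ^ 2 - x 1 ^ 2) / radSq x ^ 2; fun_prop)
      (fun c s => c * (c ^ 2 - s ^ 2)) (fun c s h => ?_) ?_
    · have h1 : |c| ≤ 1 := abs_le.2 ⟨by nlinarith, by nlinarith⟩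
      have h2 : |c ^ 2 - s ^ 2| ≤ 1 := abs_le.2 ⟨by nlinarith, by nlinarith⟩
      rw [abs_mul]; nlinarith [abs_nonneg c, abs_nonneg (c ^ 2 - s ^ 2)]
    intro x c s hx h0 h1 hcs
    have hr := rad_pos hx
    change x 0 * (x 0 ^ 2 - x 1 ^ 2) / radSq x ^ 2 = _
    rw [h0, h1, ← rad_sq]
    field_simp
  · exact locallyIntegrable_const 0

theorem isAxisPotential_logRad : IsAxisPotential logRad gradLogRad where
  locallyIntegrable := by
    refine locallyIntegrable_of_abs_le ?_ fun x hx => ?_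
    · have := measurable_radSq
      unfold logRad
      fun_prop
    have hr := rad_pos hx
    have hi : 0 < (rad x)⁻¹ := by positivity
    -- The inequality log t ≤ t - 1 at t = r and at t = 1/r bounds log r from above and from below.
    have h1 := Real.log_le_sub_one_of_pos hr
    have h2 := Real.log_le_sub_one_of_pos hi
    rw [Real.log_inv] at h2
    rw [← log_rad]
    exact abs_le.2 ⟨by linarith, by linarith⟩
  locallyIntegrable_grad := locallyIntegrable_gradLogRad
  hasFDerivAt x hx := by
    have := ((hasFDerivAt_radSq x).log hx).mul_const (2⁻¹ : ℝ)
    refine (this.congr_fderiv ?_).congr_of_eventuallyEq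
      (Filter.Eventually.of_forall fun y => by simp only [logRad, div_eq_mul_inv])
    ext v
    simp [covector_apply, Fin.sum_univ_three, gradLogRad]
    field_simp

theorem isAxisPotential_cosSq : IsAxisPotential cosSq gradCosSq where
  locallyIntegrable := by
    refine locallyIntegrable_of_abs_le ?_ fun x hx => ?_
    · have := measurable_radSq
      unfold cosSq
      fun_prop
    have hr := rad_pos hx
    have hi : 0 < (rad x)⁻¹ := by positivity
    obtain ⟨c, s, h0, h1, hcs⟩ := exists_polar hx
    have : cosSq x = c ^ 2 := by
      rw [cosSq, h0, ← rad_sq]; field_simp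
    rw [this]
    exact abs_le.2 ⟨by nlinarith, by nlinarith⟩
  locallyIntegrable_grad := locallyIntegrable_gradCosSq
  hasFDerivAt x hx := by
    have := ((hasFDerivAt_coord 0 x).pow 2).mul (hasFDerivAt_inv_radSq hx)
    refine (this.congr_fderiv ?_).congr_of_eventuallyEq
      (Filter.Eventually.of_forall fun y => by simp [cosSq, div_eq_mul_inv])
    ext v
    simp [covector_apply, Fin.sum_univ_three, gradCosSq]
    field_simp
    simp only [radSq]
    ring

theorem isAxisPotential_cosSin : IsAxisPotential cosSin gradCosSin where
  locallyIntegrable := by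
    refine locallyIntegrable_of_abs_le ?_ fun x hx => ?_
    · have := measurable_radSq
      unfold cosSin
      fun_prop
    have hr := rad_pos hx
    have hi : 0 < (rad x)⁻¹ := by positivity
    obtain ⟨c, s, h0, h1, hcs⟩ := exists_polar hx
    have : cosSin x = c * s := by
      rw [cosSin, h0, h1, ← rad_sq]; field_simp
    rw [this]
    exact abs_le.2 ⟨by nlinarith [sq_nonneg (c + s)], by nlinarith [sq_nonneg (c - s)]⟩
  locallyIntegrable_grad := locallyIntegrable_gradCosSin
  hasFDerivAt x hx := by
    have := ((hasFDerivAt_coord 0 x).mul (hasFDerivAt_coord 1 x)).mul (hasFDerivAt_inv_radSq hx)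
    refine (this.congr_fderiv ?_).congr_of_eventuallyEq
      (Filter.Eventually.of_forall fun y => by simp [cosSin, div_eq_mul_inv])
    ext v
    simp [covector_apply, Fin.sum_univ_three, gradCosSin]
    field_simp
    simp only [radSq]
    ring

/-! ### The polar angle -/

/-- The gradient of the polar angle. -/
def gradAngle (x : E3) : Fin 3 → ℝ := ![-(x 1 / radSq x), x 0 / radSq x, 0]

/-- ∇θ is ∇ log r rotated by a right angle in the (x₁, x₂)-plane, so its components are those of ∇
log r up to sign and order. -/
theorem locallyIntegrable_gradAngle (j : Fin 3) : LocallyIntegrable fun x => gradAngle x j := by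
  fin_cases j
  · exact (locallyIntegrable_gradLogRad 1).neg
  · exact locallyIntegrable_gradLogRad 0
  · exact locallyIntegrable_const 0

theorem radSq_ne_zero_of_notMem {x : E3} (hx : x ∈ closedHalfPlaneᶜ) : radSq x ≠ 0 := by
  intro h
  have h0 : x 0 = 0 := by unfold radSq at h; nlinarith [sq_nonneg (x 0), sq_nonneg (x 1)]
  have h1 : x 1 = 0 := by unfold radSq at h; nlinarith [sq_nonneg (x 0), sq_nonneg (x 1)]
  exact hx ⟨h0.ge, h1⟩

/-- θ is π plus the imaginary part of the principal logarithm of -(x₁ + i x₂), and this point lies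
in the slit plane exactly when x is off the closed half plane. -/
theorem hasFDerivAt_angle {x : E3} (hx : x ∈ closedHalfPlaneᶜ) :
    HasFDerivAt angle (covector (gradAngle x)) x := by
  let z : E3 →L[ℝ] ℂ := -((EuclideanSpace.proj 0 : E3 →L[ℝ] ℝ).smulRight (1 : ℂ) +
    (EuclideanSpace.proj 1 : E3 →L[ℝ] ℝ).smulRight Complex.I)
  have hz : ∀ y : E3, z y = -(⟨y 0, y 1⟩ : ℂ) := fun y => by
    apply Complex.ext <;> simp [z]
  have hslit : z x ∈ Complex.slitPlane := by
    rw [hz, Complex.mem_slitPlane_iff]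
    by_contra! h
    simp at h
    exact hx ⟨h.1, h.2⟩
  have hlog := (Complex.hasStrictFDerivAt_log_real hslit).hasFDerivAt.comp x z.hasFDerivAt
  have him := (Complex.imCLM.hasFDerivAt.comp x hlog).const_add Real.pi
  refine (him.congr_fderiv ?_).congr_of_eventuallyEq
    (Filter.Eventually.of_forall fun y => by simp [angle, ← hz, Complex.log_im])
  have hr := radSq_ne_zero_of_notMem hx
  ext v
  simp [covector_apply, Fin.sum_univ_three, gradAngle, hz, Complex.inv_im, Complex.inv_re,
    Complex.normSq_apply]
  have : x 0 * x 0 + x 1 * x 1 = radSq x := by unfold radSq; ring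
  rw [this]
  field_simp
  try ring

/-! ### Fubini's theorem along coordinate lines -/

/-- The point with `j`-th coordinate `t` and remaining coordinates `y`. -/
def insertCoord (j : Fin 3) (p : ℝ × (Fin 2 → ℝ)) : E3 :=
  WithLp.toLp 2 (j.insertNth (α := fun _ => ℝ) p.1 p.2)

theorem measurePreserving_insertCoord (j : Fin 3) :
    MeasurePreserving (insertCoord j) (volume.prod volume) volume :=
  (PiLp.volume_preserving_toLp (Fin 3)).comp
    (volume_preserving_piFinSuccAbove (fun _ => ℝ) j).symm

theorem measurableEmbedding_insertCoord (j : Fin 3) : MeasurableEmbedding (insertCoord j) :=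
  ((MeasurableEquiv.piFinSuccAbove (fun _ => ℝ) j).symm.trans
    (MeasurableEquiv.toLp 2 (Fin 3 → ℝ))).measurableEmbedding

theorem hasDerivAt_insertCoord (j : Fin 3) (y : Fin 2 → ℝ) (t : ℝ) :
    HasDerivAt (fun t => insertCoord j (t, y)) (e j) t := by
  have h : ∀ t, insertCoord j (t, y) = insertCoord j (0, y) + t • e j := fun t => by
    ext i
    refine Fin.succAboveCases j ?_ (fun k => ?_) i
    · simp [insertCoord, e]
    · simp [insertCoord, e]
  have h2 := ((hasDerivAt_id t).smul_const (e j)).const_add (insertCoord j (0, y))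
  simp only [id, one_smul] at h2
  exact h2.congr_of_eventuallyEq (Filter.Eventually.of_forall h)

/-- Whichever coordinate `j` is split off, `y 0` is x₁ or x₂, so a single condition on `y` keeps the
whole line away from the axis. -/
theorem radSq_insertCoord_ne_zero (j : Fin 3) (t : ℝ) {y : Fin 2 → ℝ} (hy : y 0 ≠ 0) :
    radSq (insertCoord j (t, y)) ≠ 0 := by
  have h := sq_pos_of_ne_zero hy
  have : radSq (insertCoord j (t, y)) = (j.insertNth (α := fun _ => ℝ) t y : Fin 3 → ℝ) 0 ^ 2 +
    (j.insertNth (α := fun _ => ℝ) t y : Fin 3 → ℝ) 1 ^ 2 := rfl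
  rw [this]
  have h0 : (0 : Fin 3).succAbove 0 = 1 := rfl
  have h1 : (1 : Fin 3).succAbove 0 = 0 := rfl
  have h2 : (2 : Fin 3).succAbove 0 = 0 := rfl
  fin_cases j
  · have := Fin.insertNth_apply_succAbove (α := fun _ => ℝ) (0 : Fin 3) t y 0
    rw [h0] at this
    simp only [Fin.zero_eta, this]
    positivity
  · have := Fin.insertNth_apply_succAbove (α := fun _ => ℝ) (1 : Fin 3) t y 0
    rw [h1] at this
    simp only [Fin.mk_one, this]
    positivity
  · have := Fin.insertNth_apply_succAbove (α := fun _ => ℝ) (2 : Fin 3) t y 0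
    rw [h2] at this
    simp only [Fin.reduceFinMk, this]
    positivity

/-- A partial derivative that is integrable and exists off the `x₃`-axis has integral zero if the
function is integrable. -/
theorem integral_partialDeriv_eq_zero (j : Fin 3) {f f' : E3 → ℝ} (hf : Integrable f)
    (hf' : Integrable f')
    (h : ∀ x, radSq x ≠ 0 → ∃ A : E3 →L[ℝ] ℝ, HasFDerivAt f A x ∧ A (e j) = f' x) :
    ∫ x, f' x = 0 := by
  have hmp := measurePreserving_insertCoord j
  have hF := hmp.integrable_comp_of_integrable hf
  have hF' := hmp.integrable_comp_of_integrable hf'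
  rw [← hmp.integral_comp (measurableEmbedding_insertCoord j)]
  change ∫ p, (f' ∘ insertCoord j) p ∂_ = 0
  rw [integral_prod_symm _ hF']
  have h0 : ∀ᵐ y : Fin 2 → ℝ, y 0 ≠ 0 := Measure.ae_eval_ne (fun _ => volume) 0 0
  refine integral_eq_zero_of_ae ?_
  filter_upwards [hF.prod_left_ae, hF'.prod_left_ae, h0] with y hy hy' hy0
  -- On such a line the restriction is differentiable everywhere and both it and its derivative are
  -- integrable, so there are no boundary terms.
  refine integral_eq_zero_of_hasDerivAt_of_integrable (f := fun t => f (insertCoord j (t, y)))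
    (fun t => ?_) hy' hy
  obtain ⟨A, hA, hAj⟩ := h _ (radSq_insertCoord_ne_zero j t hy0)
  have := hA.comp_hasDerivAt t (hasDerivAt_insertCoord j y t)
  rw [hAj] at this
  exact this

/-! ### Weak derivatives of axis potentials -/

/-- The partial derivative `∂ⱼ g`. -/
def partialDeriv (j : Fin 3) (g : E3 → ℝ) (x : E3) : ℝ := fderiv ℝ g x (e j)

/-- Smooth functions with compact support. -/
structure IsTest (g : E3 → ℝ) : Prop where
  contDiff : ContDiff ℝ (⊤ : ℕ∞) g
  hasCompactSupport : HasCompactSupport g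

theorem IsTest.partialDeriv {g : E3 → ℝ} (hg : IsTest g) (j : Fin 3) :
    IsTest (partialDeriv j g) where
  contDiff := (hg.contDiff.fderiv_right (m := (⊤ : ℕ∞)) (by simp)).clm_apply contDiff_const
  hasCompactSupport := hg.hasCompactSupport.fderiv_apply (𝕜 := ℝ) (e j)

theorem IsTest.differentiable {g : E3 → ℝ} (hg : IsTest g) : Differentiable ℝ g :=
  hg.contDiff.differentiable (by simp)

theorem IsTest.partialDeriv_comm {g : E3 → ℝ} (hg : IsTest g) (j k : Fin 3) (x : E3) :
    Dislocation.partialDeriv j (Dislocation.partialDeriv k g) x =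
      Dislocation.partialDeriv k (Dislocation.partialDeriv j g) x := by
  have hd : Differentiable ℝ (fderiv ℝ g) :=
    (hg.contDiff.fderiv_right (m := (⊤ : ℕ∞)) (by simp)).differentiable (by simp)
  have h : ∀ v w : E3, fderiv ℝ (fun y => fderiv ℝ g y v) x w = fderiv ℝ (fderiv ℝ g) x w v := by
    intro v w
    rw [fderiv_clm_apply (hd x) (differentiableAt_const _)]
    simp
  have hs : IsSymmSndFDerivAt ℝ g x :=
    (hg.contDiff.contDiffAt).isSymmSndFDerivAt (by simpa using WithTop.coe_le_coe.2 (le_top : (2 : ℕ∞) ≤ ⊤))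
  unfold Dislocation.partialDeriv
  rw [h, h]
  exact hs _ _

theorem IsTest.integrable_mul {g f : E3 → ℝ} (hg : IsTest g) {m : Measure E3}
    (hf : LocallyIntegrable f m) : Integrable (fun x => f x * g x) m := by
  have := hf.integrable_smul_left_of_hasCompactSupport hg.contDiff.continuous
    hg.hasCompactSupport
  simpa [smul_eq_mul, mul_comm] using this

/-- Apply the vanishing of the integral of a partial derivative to ψg. The axis leaves no residue
because almost every line in direction `j` avoids it. -/
theorem IsAxisPotential.integral_grad_mul {ψ : E3 → ℝ} {p : E3 → Fin 3 → ℝ}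
    (h : IsAxisPotential ψ p) {g : E3 → ℝ} (hg : IsTest g) (j : Fin 3) :
    ∫ x, p x j * g x = -∫ x, ψ x * partialDeriv j g x := by
  have h1 := hg.integrable_mul (h.locallyIntegrable_grad j)
  have h2 := (hg.partialDeriv j).integrable_mul h.locallyIntegrable
  have h3 := hg.integrable_mul h.locallyIntegrable
  have key := integral_partialDeriv_eq_zero j h3 (h1.add h2) fun x hx =>
    ⟨_, (h.hasFDerivAt x hx).mul (hg.differentiable x).hasFDerivAt, by
      simp [covector_e, partialDeriv]; ring⟩
  have h4 := integral_add h1 h2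
  have h5 : ∫ x, p x j * g x + ψ x * partialDeriv j g x = 0 := key
  linarith

/-- The weak gradient of an axis potential has symmetric derivatives. -/
theorem IsAxisPotential.integral_grad_mul_partialDeriv {ψ : E3 → ℝ} {p : E3 → Fin 3 → ℝ}
    (h : IsAxisPotential ψ p) {g : E3 → ℝ} (hg : IsTest g) (j k : Fin 3) :
    ∫ x, p x j * partialDeriv k g x = ∫ x, p x k * partialDeriv j g x := by
  rw [h.integral_grad_mul (hg.partialDeriv k), h.integral_grad_mul (hg.partialDeriv j)]
  simp only [hg.partialDeriv_comm]

/-! ### The circulation of the gradient of the polar angle -/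

/-- Cartesian coordinates with the third coordinate split off. -/
def splitCoord (p : ℝ × (ℝ × ℝ)) : E3 := !₂[p.2.1, p.2.2, p.1]

theorem splitCoord_eq : splitCoord =
    insertCoord 2 ∘ Prod.map id (MeasurableEquiv.finTwoArrow (α := ℝ)).symm := by
  funext p
  ext i
  fin_cases i <;> rfl

theorem measurePreserving_splitCoord :
    MeasurePreserving splitCoord (volume.prod volume) volume := by
  rw [splitCoord_eq]
  exact (measurePreserving_insertCoord 2).comp
    ((MeasurePreserving.id _).prod (volume_preserving_finTwoArrow ℝ).symm)

theorem measurableEmbedding_splitCoord : MeasurableEmbedding splitCoord := by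
  rw [splitCoord_eq]
  exact (measurableEmbedding_insertCoord 2).comp
    ((MeasurableEquiv.refl ℝ).prodCongr (MeasurableEquiv.finTwoArrow (α := ℝ)).symm
      ).measurableEmbedding

/-- The integral of a radial derivative along a ray. -/
theorem integral_ray {g : E3 → ℝ} (hg : IsTest g) (s φ : ℝ) :
    ∫ r in Set.Ioi (0 : ℝ), fderiv ℝ g (!₂[r * Real.cos φ, r * Real.sin φ, s])
      (!₂[Real.cos φ, Real.sin φ, 0]) = -g (s • e 2) := by
  let v : E3 := !₂[Real.cos φ, Real.sin φ, 0]
  have hv : v ≠ 0 := by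
    intro h
    have h0 := congrArg (fun w : E3 => w 0) h
    have h1 := congrArg (fun w : E3 => w 1) h
    simp [v] at h0 h1
    have := Real.sin_sq_add_cos_sq φ
    rw [h0, h1] at this
    norm_num at this
  have hline : ∀ r : ℝ, (!₂[r * Real.cos φ, r * Real.sin φ, s] : E3) = s • e 2 + r • v := by
    intro r
    ext i
    fin_cases i <;> simp [v, e]
  have hd : ∀ r : ℝ, HasDerivAt (fun r : ℝ => g (s • e 2 + r • v))
      (fderiv ℝ g (s • e 2 + r • v) v) r := fun r => by
    have h1 := ((hasDerivAt_id r).smul_const v).const_add (s • e 2)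
    simp only [id, one_smul] at h1
    exact (hg.differentiable _).hasFDerivAt.comp_hasDerivAt r h1
  have hemb : Topology.IsClosedEmbedding (fun r : ℝ => s • e 2 + r • v) :=
    (Homeomorph.addLeft (s • e 2)).isClosedEmbedding.comp (isClosedEmbedding_smul_left hv)
  have hc : HasCompactSupport (fun r : ℝ => g (s • e 2 + r • v)) :=
    hg.hasCompactSupport.comp_isClosedEmbedding hemb
  have hc' : HasCompactSupport (fun r : ℝ => fderiv ℝ g (s • e 2 + r • v) v) :=
    (hg.hasCompactSupport.fderiv_apply (𝕜 := ℝ) v).comp_isClosedEmbedding hemb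
  have hcont : Continuous (fun r : ℝ => fderiv ℝ g (s • e 2 + r • v) v) := by
    have := hg.contDiff.continuous_fderiv (by simp)
    fun_prop
  simp only [hline]
  -- Compact support kills the value at infinity; what remains is the value at r = 0, which is the
  -- axis point of height `s`.
  have := integral_Ioi_of_hasDerivAt_of_tendsto' (a := 0) (fun r _ => hd r)
    (hcont.integrable_of_hasCompactSupport hc').integrableOn
    (hc.is_zero_at_infty.mono_left atTop_le_cocompact)
  rw [this]
  simp

/-- Every ray contributes -g at the same axis point, and the angles fill an interval of length 2π.
-/
theorem integral_polar_radialDeriv {g : E3 → ℝ} (hg : IsTest g) (s : ℝ) :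
    ∫ p in polarCoord.target, fderiv ℝ g (!₂[p.1 * Real.cos p.2, p.1 * Real.sin p.2, s])
      (!₂[Real.cos p.2, Real.sin p.2, 0]) = -(2 * Real.pi) * g (s • e 2) := by
  let D : ℝ × ℝ → ℝ := fun p => fderiv ℝ g (!₂[p.1 * Real.cos p.2, p.1 * Real.sin p.2, s])
    (!₂[Real.cos p.2, Real.sin p.2, 0])
  have hcont : Continuous D := by
    have h1 := hg.contDiff.continuous_fderiv (by simp)
    have h2 : Continuous fun p : ℝ × ℝ =>
        (!₂[p.1 * Real.cos p.2, p.1 * Real.sin p.2, s] : E3) := by fun_prop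
    have h3 : Continuous fun p : ℝ × ℝ => (!₂[Real.cos p.2, Real.sin p.2, 0] : E3) := by fun_prop
    exact (h1.comp h2).clm_apply h3
  obtain ⟨R, hR⟩ := (hg.hasCompactSupport.fderiv (𝕜 := ℝ)).isCompact.isBounded.subset_closedBall 0
  -- Beyond radius `R` the integrand vanishes, so the integral over the unbounded strip reduces to a
  -- compact rectangle. This supplies the integrability needed to integrate over the radius first.
  have hzero : ∀ p : ℝ × ℝ, R < p.1 → 0 < p.1 → D p = 0 := by
    intro p hp hp0
    have hnot : (!₂[p.1 * Real.cos p.2, p.1 * Real.sin p.2, s] : E3) ∉ tsupport (fderiv ℝ g) := by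
      intro hmem
      have h1 := hR hmem
      rw [mem_closedBall_zero_iff, EuclideanSpace.norm_eq] at h1
      refine absurd (hp.trans_le (le_trans ?_ h1)) (lt_irrefl _)
      refine Real.le_sqrt_of_sq_le ?_
      simp [Fin.sum_univ_three]
      nlinarith [Real.sin_sq_add_cos_sq p.2, sq_nonneg s]
    simp only [D, image_eq_zero_of_notMem_tsupport hnot]
    rfl
  have htarget : polarCoord.target = Set.Ioi (0 : ℝ) ×ˢ Set.Ioo (-Real.pi) Real.pi := rfl
  have hint : IntegrableOn D (Set.Ioi (0 : ℝ) ×ˢ Set.Ioo (-Real.pi) Real.pi) := by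
    have hK : IntegrableOn D (Set.Icc (0 : ℝ) R ×ˢ Set.Icc (-Real.pi) Real.pi) :=
      hcont.continuousOn.integrableOn_compact (isCompact_Icc.prod isCompact_Icc)
    refine hK.of_forall_sdiff_eq_zero (measurableSet_Ioi.prod measurableSet_Ioo) fun p hp => ?_
    refine hzero p ?_ hp.1.1
    by_contra! h
    exact hp.2 ⟨⟨le_of_lt hp.1.1, h⟩, Set.Ioo_subset_Icc_self hp.1.2⟩
  rw [htarget]
  rw [IntegrableOn, Measure.volume_eq_prod, ← Measure.prod_restrict] at hint
  rw [Measure.volume_eq_prod, ← Measure.prod_restrict]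
  refine (integral_prod_symm D hint).trans ?_
  simp only [D, integral_ray hg]
  simp only [integral_const, smul_eq_mul, measureReal_restrict_apply_univ, Real.volume_real_Ioo,
    sub_neg_eq_add]
  rw [max_eq_left (by positivity)]
  ring

/-- `∫ ∇(log r) · ∇g = -2π ∫ g`, where the second integral is over the axis. -/
theorem integral_gradLogRad_mul {g : E3 → ℝ} (hg : IsTest g) :
    ∫ x, (gradLogRad x 0 * partialDeriv 0 g x + gradLogRad x 1 * partialDeriv 1 g x) =
      -(2 * Real.pi) * ∫ s : ℝ, g (s • e 2) := by
  let F : E3 → ℝ := fun x =>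
      gradLogRad x 0 * partialDeriv 0 g x + gradLogRad x 1 * partialDeriv 1 g x
  have hint : Integrable F :=
    ((hg.partialDeriv 0).integrable_mul (locallyIntegrable_gradLogRad 0)).add
      ((hg.partialDeriv 1).integrable_mul (locallyIntegrable_gradLogRad 1))
  have hmp := measurePreserving_splitCoord
  change ∫ x, F x = _
  rw [← hmp.integral_comp measurableEmbedding_splitCoord]
  change ∫ p, (F ∘ splitCoord) p ∂_ = _
  rw [integral_prod _ (hmp.integrable_comp_of_integrable hint), ← integral_const_mul]
  refine integral_congr_ae (Filter.Eventually.of_forall fun s => ?_)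
  change ∫ q : ℝ × ℝ, F (splitCoord (s, q)) = -(2 * Real.pi) * g (s • e 2)
  -- The polar Jacobian r times ∇ log r is the unit radial vector, so the integrand becomes the
  -- radial derivative of `g`.
  rw [← integral_comp_polarCoord_symm, ← integral_polar_radialDeriv hg s]
  refine setIntegral_congr_fun polarCoord.open_target.measurableSet fun p hp => ?_
  have hp0 : p.1 ≠ 0 := ne_of_gt hp.1
  have hdir : (!₂[Real.cos p.2, Real.sin p.2, 0] : E3) =
      Real.cos p.2 • e 0 + Real.sin p.2 • e 1 := by
    ext i
    fin_cases i <;> simp [e]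
  have hx : splitCoord (s, polarCoord.symm p) =
      !₂[p.1 * Real.cos p.2, p.1 * Real.sin p.2, s] := by
    simp [splitCoord, polarCoord_symm_apply]
  have hr : radSq (!₂[p.1 * Real.cos p.2, p.1 * Real.sin p.2, s] : E3) = p.1 ^ 2 := by
    simp [radSq]
    linear_combination p.1 ^ 2 * Real.sin_sq_add_cos_sq p.2
  simp only [F, hx, hdir, map_add, map_smul, partialDeriv, gradLogRad, hr, smul_eq_mul]
  simp
  field_simp

/-! ### Fields with circulation around the axis -/

theorem IsAxisPotential.add {ψ χ : E3 → ℝ} {p q : E3 → Fin 3 → ℝ} (h : IsAxisPotential ψ p)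
    (h' : IsAxisPotential χ q) : IsAxisPotential (ψ + χ) (p + q) where
  locallyIntegrable := h.locallyIntegrable.add h'.locallyIntegrable
  locallyIntegrable_grad j := (h.locallyIntegrable_grad j).add (h'.locallyIntegrable_grad j)
  hasFDerivAt x hx := by
    rw [Pi.add_apply, covector_add]
    exact (h.hasFDerivAt x hx).add (h'.hasFDerivAt x hx)

theorem IsAxisPotential.const_smul {ψ : E3 → ℝ} {p : E3 → Fin 3 → ℝ} (h : IsAxisPotential ψ p)
    (c : ℝ) : IsAxisPotential (c • ψ) (c • p) where
  locallyIntegrable := h.locallyIntegrable.smul c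
  locallyIntegrable_grad j := (h.locallyIntegrable_grad j).smul c
  hasFDerivAt x hx := by
    rw [Pi.smul_apply, covector_smul]
    exact (h.hasFDerivAt x hx).const_smul c

/-- The rotation of the locally integrable field `p` is `a e₃` times the arc length measure of the
`x₃`-axis. -/
structure HasCirculation (p : E3 → Fin 3 → ℝ) (a : ℝ) : Prop where
  locallyIntegrable : ∀ j, LocallyIntegrable fun x => p x j
  curl_zero : ∀ g, IsTest g →
    ∫ x, p x 1 * partialDeriv 2 g x = ∫ x, p x 2 * partialDeriv 1 g x
  curl_one : ∀ g, IsTest g →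
    ∫ x, p x 2 * partialDeriv 0 g x = ∫ x, p x 0 * partialDeriv 2 g x
  curl_two : ∀ g, IsTest g →
    ∫ x, p x 0 * partialDeriv 1 g x =
      (∫ x, p x 1 * partialDeriv 0 g x) + a * ∫ s : ℝ, g (s • e 2)

/-- A single-valued potential contributes nothing to the curl, despite its singularity on the axis.
-/
theorem IsAxisPotential.hasCirculation {ψ : E3 → ℝ} {p : E3 → Fin 3 → ℝ}
    (h : IsAxisPotential ψ p) : HasCirculation p 0 where
  locallyIntegrable := h.locallyIntegrable_grad
  curl_zero _ hg := h.integral_grad_mul_partialDeriv hg _ _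
  curl_one _ hg := h.integral_grad_mul_partialDeriv hg _ _
  curl_two _ hg := by rw [h.integral_grad_mul_partialDeriv hg, zero_mul, add_zero]

theorem HasCirculation.const_smul {p : E3 → Fin 3 → ℝ} {a : ℝ} (h : HasCirculation p a) (c : ℝ) :
    HasCirculation (c • p) (c * a) where
  locallyIntegrable j := (h.locallyIntegrable j).smul c
  curl_zero g hg := by
    simp only [Pi.smul_apply, smul_eq_mul, mul_assoc, integral_const_mul, h.curl_zero g hg]
  curl_one g hg := by
    simp only [Pi.smul_apply, smul_eq_mul, mul_assoc, integral_const_mul, h.curl_one g hg]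
  curl_two g hg := by
    simp only [Pi.smul_apply, smul_eq_mul, mul_assoc, integral_const_mul, h.curl_two g hg]
    ring

theorem HasCirculation.add {p q : E3 → Fin 3 → ℝ} {a b : ℝ} (h : HasCirculation p a)
    (h' : HasCirculation q b) : HasCirculation (p + q) (a + b) := by
  have key : ∀ g, IsTest g → ∀ j k, ∫ x, (p + q) x j * partialDeriv k g x =
      (∫ x, p x j * partialDeriv k g x) + ∫ x, q x j * partialDeriv k g x := by
    intro g hg j k
    rw [← integral_add ((hg.partialDeriv k).integrable_mul (h.locallyIntegrable j))
      ((hg.partialDeriv k).integrable_mul (h'.locallyIntegrable j))]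
    simp only [Pi.add_apply, add_mul]
  refine ⟨fun j => (h.locallyIntegrable j).add (h'.locallyIntegrable j), ?_, ?_, ?_⟩
  · intro g hg
    rw [key g hg, key g hg, h.curl_zero g hg, h'.curl_zero g hg]
  · intro g hg
    rw [key g hg, key g hg, h.curl_one g hg, h'.curl_one g hg]
  · intro g hg
    rw [key g hg, key g hg, h.curl_two g hg, h'.curl_two g hg]
    ring

/-- `log r` does not depend on `x₃`, so neither do its derivatives. -/
theorem integral_gradLogRad_mul_partialDeriv_two {g : E3 → ℝ} (hg : IsTest g) (j : Fin 3) :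
    ∫ x, gradLogRad x j * partialDeriv 2 g x = 0 := by
  rw [isAxisPotential_logRad.integral_grad_mul_partialDeriv hg]
  simp [gradLogRad]

/-- The jump of θ rules out integrating by parts against θ itself. Instead ∇θ = (-∂₂ log r, ∂₁ log
r, 0) turns the third curl component into the weak Laplacian of log r, and the other two into
x₃-derivatives of ∇ log r, which vanish. -/
theorem hasCirculation_gradAngle : HasCirculation gradAngle (2 * Real.pi) where
  locallyIntegrable := locallyIntegrable_gradAngle
  curl_zero g hg := by
    refine (integral_gradLogRad_mul_partialDeriv_two hg 0).trans ?_
    simp [gradAngle]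
  curl_one g hg := by
    have h : ∫ x, gradAngle x 0 * partialDeriv 2 g x =
        ∫ x, -(gradLogRad x 1 * partialDeriv 2 g x) := by
      simp [gradAngle, gradLogRad]
    rw [h, integral_neg, integral_gradLogRad_mul_partialDeriv_two hg]
    simp [gradAngle]
  curl_two g hg := by
    have h := integral_gradLogRad_mul hg
    rw [integral_add ((hg.partialDeriv 0).integrable_mul (locallyIntegrable_gradLogRad 0))
      ((hg.partialDeriv 1).integrable_mul (locallyIntegrable_gradLogRad 1))] at h
    have h0 : ∫ x, gradAngle x 0 * partialDeriv 1 g x =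
        ∫ x, -(gradLogRad x 1 * partialDeriv 1 g x) := by
      simp [gradAngle, gradLogRad]
    have h1 : ∫ x, gradAngle x 1 * partialDeriv 0 g x =
        ∫ x, gradLogRad x 0 * partialDeriv 0 g x := by
      simp [gradAngle, gradLogRad]
    rw [h0, h1, integral_neg]
    linarith

/-! ### Distributions defined by matrix fields -/

theorem locallyIntegrable_matrix {F : E3 → M3}
    (hF : ∀ i j, LocallyIntegrable fun x => F x i j) : LocallyIntegrable F := by
  rw [locallyIntegrable_iff]
  intro K hK
  exact Integrable.of_eval fun i => Integrable.of_eval fun j =>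
    (hF i j).integrableOn_isCompact hK

theorem isTest_vector (φ : 𝓓((⊤ : Opens E3), E3)) (i : Fin 3) : IsTest fun x => φ x i where
  contDiff := (EuclideanSpace.proj i : E3 →L[ℝ] ℝ).contDiff.comp φ.contDiff
  hasCompactSupport := φ.hasCompactSupport.comp_left (g := fun v : E3 => v i) rfl

theorem isTest_matrix (φ : 𝓓((⊤ : Opens E3), M3)) (i j : Fin 3) :
    IsTest fun x => φ x i j where
  contDiff := contDiff_pi.1 (contDiff_pi.1 φ.contDiff i) j
  hasCompactSupport := φ.hasCompactSupport.comp_left (g := fun A : M3 => A i j) rfl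

theorem testGrad_eq_partialDeriv (φ : 𝓓((⊤ : Opens E3), E3)) (x : E3) (i j : Fin 3) :
    testGrad φ x i j = partialDeriv j (fun y => φ y i) x := by
  rw [testGrad_apply, partialDeriv]
  have h := (φ.contDiff.differentiable (by simp) x).hasFDerivAt
  have h' : HasFDerivAt (fun y => φ y i)
      ((EuclideanSpace.proj i : E3 →L[ℝ] ℝ).comp (fderiv ℝ φ x)) x :=
    (EuclideanSpace.proj i : E3 →L[ℝ] ℝ).hasFDerivAt.comp x h
  rw [h'.fderiv]
  rfl

theorem testRot_eq_partialDeriv (φ : 𝓓((⊤ : Opens E3), M3)) (x : E3) (i j : Fin 3) :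
    testRot φ x i j = partialDeriv (j + 1) (fun y => φ y i (j + 2)) x -
      partialDeriv (j + 2) (fun y => φ y i (j + 1)) x := by
  have h := (φ.contDiff.differentiable (by simp) x).hasFDerivAt
  have h' : ∀ k l, partialDeriv k (fun y => φ y i l) x = fderiv ℝ φ x (e k) i l := fun k l => by
    rw [partialDeriv, (hasFDerivAt_pi'.1 (hasFDerivAt_pi'.1 h i) l).fderiv]
    rfl
  rw [testRot_apply, h', h']

theorem integrable_dotdot {F : E3 → M3} (hF : LocallyIntegrable F)
    (φ : 𝓓((⊤ : Opens E3), M3)) : Integrable fun x => dotdot (F x) (φ x) := by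
  have h : ∀ i j, LocallyIntegrable fun x => F x i j := fun i j => by
    rw [locallyIntegrable_iff] at hF ⊢
    exact fun K hK => ((hF K hK).eval i).eval j
  exact integrable_finsetSum _ fun i _ => integrable_finsetSum _ fun j _ =>
    (isTest_matrix φ i j).integrable_mul (h i j)

/-- A matrix field whose rows have circulation `bᵢ` has rotation `b ⊗ e₃` on the axis. -/
theorem distRot_distOf_eq_nyeMeasure {F : E3 → M3} {b : E3}
    (hF : ∀ i, HasCirculation (fun x => F x i) (b i)) :
    distRot (distOf volume F) = nyeMeasure b := by
  have hloc : LocallyIntegrable F := locallyIntegrable_matrix fun i j => (hF i).locallyIntegrable j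
  ext φ
  rw [nyeMeasure_apply]
  change distOf volume F (testRot φ) = _
  rw [distOf_apply hloc]
  have hI : ∀ i k l m, Integrable fun x => F x i k * partialDeriv l (fun y => φ y i m) x :=
    fun i k l m => ((isTest_matrix φ i m).partialDeriv l).integrable_mul ((hF i).locallyIntegrable k)
  have hrow : ∀ i, ∫ x, ∑ j, F x i j * testRot φ x i j =
      b i * ∫ s : ℝ, φ (s • e 2) i 2 := by
    intro i
    simp only [testRot_eq_partialDeriv, mul_sub]
    rw [integral_finsetSum _ fun j _ => by exact (hI i j _ _).sub (hI i j _ _)]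
    simp_rw [integral_sub (hI i _ _ _) (hI i _ _ _)]
    -- Regrouped by the entry of `φ` that is differentiated, the six terms form the three curl
    -- identities; only the entry in column 2 meets the axis.
    have h0 := (hF i).curl_zero _ (isTest_matrix φ i 0)
    have h1 := (hF i).curl_one _ (isTest_matrix φ i 1)
    have h2 := (hF i).curl_two _ (isTest_matrix φ i 2)
    rw [Fin.sum_univ_three]
    have e1 : (1 : Fin 3) + 1 = 2 := rfl
    have e2 : (1 : Fin 3) + 2 = 0 := rfl
    have e3 : (2 : Fin 3) + 1 = 0 := rfl
    have e4 : (2 : Fin 3) + 2 = 1 := rfl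
    rw [zero_add, zero_add, e1, e2, e3, e4]
    linarith
  simp only [dotdot]
  rw [integral_finsetSum _ fun i _ => integrable_finsetSum _ fun j _ =>
    (isTest_matrix (testRot φ) i j).integrable_mul ((hF i).locallyIntegrable j)]
  simp only [hrow]
  have haxis : ∀ i, Integrable fun s : ℝ => b i * φ (s • e 2) i 2 := fun i =>
    (((isTest_matrix φ i 2).contDiff.continuous.comp
      isClosedEmbedding_axis.continuous).integrable_of_hasCompactSupport
        ((isTest_matrix φ i 2).hasCompactSupport.comp_isClosedEmbedding
          isClosedEmbedding_axis)).const_mul _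
  simp only [← integral_const_mul]
  rw [← integral_finsetSum _ fun i _ => haxis i]
  simp [tensor, e]

/-- Rows of the form `(∂₂ψ, -∂₁ψ, c ∂ₖ log r)` are divergence free. -/
theorem integral_div_eq_zero {ψ : E3 → ℝ} {q p : E3 → Fin 3 → ℝ} (h : IsAxisPotential ψ q)
    (c : ℝ) (k : Fin 3) (h0 : ∀ x, p x 0 = q x 1) (h1 : ∀ x, p x 1 = -q x 0)
    (h2 : ∀ x, p x 2 = c * gradLogRad x k) {g : E3 → ℝ} (hg : IsTest g) :
    ∫ x, ∑ j, p x j * partialDeriv j g x = 0 := by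
  have i0 := (hg.partialDeriv 0).integrable_mul (h.locallyIntegrable_grad 1)
  have i1 := (hg.partialDeriv 1).integrable_mul (h.locallyIntegrable_grad 0)
  have i2 := ((hg.partialDeriv 2).integrable_mul (locallyIntegrable_gradLogRad k)).const_mul c
  have hsum : ∀ x, ∑ j, p x j * partialDeriv j g x = q x 1 * partialDeriv 0 g x -
      q x 0 * partialDeriv 1 g x + c * (gradLogRad x k * partialDeriv 2 g x) := fun x => by
    rw [Fin.sum_univ_three, h0, h1, h2]; ring
  simp only [hsum]
  rw [integral_add (by exact i0.sub i1) i2, integral_sub i0 i1, integral_const_mul,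
    integral_gradLogRad_mul_partialDeriv_two hg, h.integral_grad_mul_partialDeriv hg 1 0]
  simp

theorem distDiv_distOf_eq_zero {F : E3 → M3} (hF : LocallyIntegrable F)
    (h : ∀ i, ∀ g, IsTest g → ∫ x, ∑ j, F x i j * partialDeriv j g x = 0) :
    distDiv (distOf volume F) = 0 := by
  have hloc : ∀ i j, LocallyIntegrable fun x => F x i j := fun i j => by
    rw [locallyIntegrable_iff] at hF ⊢
    exact fun K hK => ((hF K hK).eval i).eval j
  ext φ
  change -(distOf volume F (testGrad φ)) = 0
  rw [distOf_apply hF, neg_eq_zero]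
  simp only [dotdot, testGrad_eq_partialDeriv]
  rw [integral_finsetSum _ fun i _ => integrable_finsetSum _ fun j _ =>
    ((isTest_vector φ i).partialDeriv j).integrable_mul (hloc i j)]
  exact Finset.sum_eq_zero fun i _ => h i _ (isTest_vector φ i)

theorem distOf_congr_ae {F G : E3 → M3} (hG : LocallyIntegrable G) (h : F =ᵐ[volume] G) :
    distOf volume F = distOf volume G := by
  have hF : LocallyIntegrable F := hG.congr h.symm
  ext φ
  rw [distOf_apply hF, distOf_apply hG]
  refine integral_congr_ae ?_
  filter_upwards [h] with x hx
  rw [hx]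

/-- Hooke's law `D_I ε(A) = lam trace(ε(A)) I + 2 mu ε(A)` for a matrix `A`. -/
def hooke (lam mu : ℝ) (A : M3) : M3 := fun i j =>
  lam * (∑ k, A k k) * (if i = j then 1 else 0) + mu * (A i j + A j i)

theorem distElasticity_distSym_distOf (lam mu : ℝ) {F : E3 → M3} (hF : LocallyIntegrable F)
    {T : E3 → M3} (hT : LocallyIntegrable T) (h : ∀ x, T x = hooke lam mu (F x)) :
    distOf volume T = distElasticity lam mu (distSym (distOf volume F)) := by
  ext φ
  -- By duality D_I and ε are moved onto the test function: `φ₁` is ε(trace(φ) I) and `φ₂` is ε(φ).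
  let φ₁ := TestFunction.postcompCLM (𝕜 := ℝ) symPart
    (TestFunction.postcompCLM (𝕜 := ℝ) scalarMatrix (TestFunction.postcompCLM (𝕜 := ℝ) traceCLM φ))
  let φ₂ := TestFunction.postcompCLM (𝕜 := ℝ) symPart φ
  change distOf volume T φ = lam * distOf volume F φ₁ + (2 * mu) * distOf volume F φ₂
  rw [distOf_apply hT, distOf_apply hF, distOf_apply hF, ← integral_const_mul,
    ← integral_const_mul, ← integral_add ((integrable_dotdot hF _).const_mul _)
      ((integrable_dotdot hF _).const_mul _)]
  refine integral_congr_ae (Filter.Eventually.of_forall fun x => ?_)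
  have h1 : φ₁ x = symPart (scalarMatrix (traceCLM (φ x))) := rfl
  have h2 : φ₂ x = symPart (φ x) := rfl
  simp only [h1, h2, h]
  simp [dotdot, hooke, Fin.sum_univ_three, symPart, scalarMatrix, traceCLM]
  ring

/-! ### The displacement and stress fields -/

/-- The hypotheses give 3(lam + mu) > mu > 0, hence lam + mu and lam + 2 mu are positive. The second
identity eliminates lam from the trace term of Hooke's law. -/
theorem poisson_identities {lam mu : ℝ} (hmu : 0 < mu) (hlam : 0 < 3 * lam + 2 * mu) :
    1 - poisson lam mu ≠ 0 ∧ lam * (1 - 2 * poisson lam mu) = 2 * mu * poisson lam mu := by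
  have h1 : 0 < lam + mu := by linarith
  have h2 : 0 < lam + 2 * mu := by linarith
  have h3 : 1 - poisson lam mu = (lam + 2 * mu) / (2 * (lam + mu)) := by
    unfold poisson; field_simp; ring
  refine ⟨by rw [h3]; positivity, ?_⟩
  unfold poisson; field_simp; ring

/-- The gradient of the displacement field by its rows. -/
def gradDisplacement (lam mu b₁ b₃ : ℝ) (x : E3) : M3 :=
  ![((b₁ / (2 * Real.pi)) • gradAngle +
      (b₁ / (2 * Real.pi) * (1 / (2 * (1 - poisson lam mu)))) • gradCosSin) x,
    (-(b₁ / (4 * Real.pi * (1 - poisson lam mu))) •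
      ((1 - 2 * poisson lam mu) • gradLogRad + gradCosSq)) x,
    ((b₃ / (2 * Real.pi)) • gradAngle) x]

/-- Only the multiples of ∇θ carry circulation, and 2π cancels their denominators. The second row is
the gradient of an axis potential, which matches b₂ = 0. -/
theorem hasCirculation_gradDisplacement (lam mu b₁ b₃ : ℝ) (i : Fin 3) :
    HasCirculation (fun x => gradDisplacement lam mu b₁ b₃ x i) ((!₂[b₁, 0, b₃] : E3) i) := by
  have hpi := Real.pi_ne_zero
  fin_cases i
  · have h := (hasCirculation_gradAngle.const_smul (b₁ / (2 * Real.pi))).add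
      (isAxisPotential_cosSin.const_smul
        (b₁ / (2 * Real.pi) * (1 / (2 * (1 - poisson lam mu))))).hasCirculation
    have hb : b₁ / (2 * Real.pi) * (2 * Real.pi) + 0 = b₁ := by field_simp; simp
    rw [hb] at h
    exact h
  · exact (((isAxisPotential_logRad.const_smul (1 - 2 * poisson lam mu)).add
      isAxisPotential_cosSq).const_smul
        (-(b₁ / (4 * Real.pi * (1 - poisson lam mu))))).hasCirculation
  · have h := hasCirculation_gradAngle.const_smul (b₃ / (2 * Real.pi))
    have hb : b₃ / (2 * Real.pi) * (2 * Real.pi) = b₃ := by field_simp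
    rw [hb] at h
    exact h

theorem hasFDerivAt_displacement_coord (lam mu b₁ b₃ : ℝ) {x : E3} (hx : x ∈ closedHalfPlaneᶜ)
    (i : Fin 3) : HasFDerivAt (fun y => displacement lam mu b₁ b₃ y i)
      (covector (gradDisplacement lam mu b₁ b₃ x i)) x := by
  have hr := radSq_ne_zero_of_notMem hx
  have hθ := hasFDerivAt_angle hx
  fin_cases i
  · have h := (hθ.const_smul (b₁ / (2 * Real.pi))).add
      ((isAxisPotential_cosSin.hasFDerivAt x hr).const_smul
        (b₁ / (2 * Real.pi) * (1 / (2 * (1 - poisson lam mu)))))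
    rw [← covector_smul, ← covector_smul, ← covector_add] at h
    refine h.congr_of_eventuallyEq (Filter.Eventually.of_forall fun y => ?_)
    simp [displacement, rad_sq, cosSin]
    ring
  · have h := (((isAxisPotential_logRad.const_smul (1 - 2 * poisson lam mu)).add
      isAxisPotential_cosSq).const_smul
        (-(b₁ / (4 * Real.pi * (1 - poisson lam mu))))).hasFDerivAt x hr
    refine h.congr_of_eventuallyEq (Filter.Eventually.of_forall fun y => ?_)
    simp [displacement, rad_sq, cosSq, log_rad]
  · have h := hθ.const_smul (b₃ / (2 * Real.pi))
    rw [← covector_smul] at h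
    refine h.congr_of_eventuallyEq (Filter.Eventually.of_forall fun y => ?_)
    simp [displacement]

theorem differentiableAt_displacement (lam mu b₁ b₃ : ℝ) {x : E3}
    (hx : x ∈ closedHalfPlaneᶜ) : DifferentiableAt ℝ (displacement lam mu b₁ b₃) x :=
  differentiableAt_euclidean.2 fun i =>
    (hasFDerivAt_displacement_coord lam mu b₁ b₃ hx i).differentiableAt

theorem displacementGrad_eq (lam mu b₁ b₃ : ℝ) {x : E3} (hx : x ∈ closedHalfPlaneᶜ) :
    displacementGrad lam mu b₁ b₃ x = gradDisplacement lam mu b₁ b₃ x := by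
  funext i j
  have h := (differentiableAt_displacement lam mu b₁ b₃ hx).hasFDerivAt
  have h2 := ((EuclideanSpace.proj i : E3 →L[ℝ] ℝ).hasFDerivAt.comp x h).unique
    (hasFDerivAt_displacement_coord lam mu b₁ b₃ hx i)
  have h3 := congrArg (fun A : E3 →L[ℝ] ℝ => A (e j)) h2
  simp only [covector_e] at h3
  exact h3

theorem displacementGrad_ae_eq (lam mu b₁ b₃ : ℝ) :
    displacementGrad lam mu b₁ b₃ =ᵐ[volume] gradDisplacement lam mu b₁ b₃ := by
  -- The closed half plane lies in the null set where x₂ = 0.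
  filter_upwards [ae_coord_ne_zero 1] with x hx
  exact displacementGrad_eq lam mu b₁ b₃ fun h => hx h.2

theorem locallyIntegrable_gradDisplacement (lam mu b₁ b₃ : ℝ) :
    LocallyIntegrable (gradDisplacement lam mu b₁ b₃) :=
  locallyIntegrable_matrix fun i j =>
    (hasCirculation_gradDisplacement lam mu b₁ b₃ i).locallyIntegrable j

/-! ### Hooke's law and equilibrium of the stress -/

theorem eq_zero_of_radSq_eq_zero {x : E3} (h : radSq x = 0) : x 0 = 0 ∧ x 1 = 0 := by
  unfold radSq at h
  constructor <;> nlinarith [sq_nonneg (x 0), sq_nonneg (x 1)]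

theorem stress_eq_hooke {lam mu : ℝ} (b₁ b₃ : ℝ) (hmu : 0 < mu) (hlam : 0 < 3 * lam + 2 * mu)
    (x : E3) : stress lam mu b₁ b₃ x = hooke lam mu (gradDisplacement lam mu b₁ b₃ x) := by
  obtain ⟨hν, hid⟩ := poisson_identities hmu hlam
  have hpi := Real.pi_ne_zero
  -- On the axis both sides are zero, as x₁ = x₂ = 0 and division by zero gives zero, so the
  -- identity holds at every point.
  by_cases hr : radSq x = 0
  · obtain ⟨h0, h1⟩ := eq_zero_of_radSq_eq_zero hr
    funext i j
    fin_cases i <;> fin_cases j <;>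
      simp [stress, hooke, gradDisplacement, gradAngle, gradCosSin, gradCosSq, gradLogRad, h0, h1,
        Fin.sum_univ_three]
  · have hs : radSq x = x 0 ^ 2 + x 1 ^ 2 := rfl
    -- The trace term shared by the diagonal entries; once lam (1 - 2ν) is replaced by 2 mu ν, only
    -- mu and ν remain.
    have htr : lam *
        (-(b₁ / (2 * Real.pi) * (x 1 / radSq x)) +
            b₁ / (2 * Real.pi) * ((1 - poisson lam mu)⁻¹ * 2⁻¹) *
              (x 1 * (x 1 ^ 2 - x 0 ^ 2) / radSq x ^ 2) +
          -(b₁ / (4 * Real.pi * (1 - poisson lam mu)) *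
              ((1 - 2 * poisson lam mu) * (x 1 / radSq x) +
                -(2 * x 0 ^ 2 * x 1 / radSq x ^ 2)))) =
        -(2 * mu * poisson lam mu * b₁ * x 1) /
          (2 * Real.pi * (1 - poisson lam mu) * radSq x) := by
      rw [← hid]
      field_simp
      rw [hs]
      ring
    funext i j
    fin_cases i <;> fin_cases j <;>
      simp [stress, hooke, gradDisplacement, gradAngle, gradCosSin, gradCosSq, gradLogRad,
        rad_sq, rad_pow_four, Fin.sum_univ_three]
    all_goals
      try rw [htr]
      field_simp
      try rw [hs]
      try ring

theorem locallyIntegrable_stress {lam mu : ℝ} (b₁ b₃ : ℝ) (hmu : 0 < mu)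
    (hlam : 0 < 3 * lam + 2 * mu) : LocallyIntegrable (stress lam mu b₁ b₃) := by
  have h : ∀ i j, LocallyIntegrable fun x => gradDisplacement lam mu b₁ b₃ x i j := fun i =>
    (hasCirculation_gradDisplacement lam mu b₁ b₃ i).locallyIntegrable
  refine locallyIntegrable_matrix fun i j => ?_
  simp only [stress_eq_hooke b₁ b₃ hmu hlam, hooke, Fin.sum_univ_three, mul_comm _ (ite _ _ _)]
  exact (((((h 0 0).add (h 1 1)).add (h 2 2)).smul lam).smul (if i = j then (1 : ℝ) else 0)).add
    (((h i j).add (h j i)).smul mu)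

theorem integral_stress_row (lam mu b₁ b₃ : ℝ) (i : Fin 3) {g : E3 → ℝ} (hg : IsTest g) :
    ∫ x, ∑ j, stress lam mu b₁ b₃ x i j * partialDeriv j g x = 0 := by
  let D₁ := mu * b₁ / (2 * Real.pi * (1 - poisson lam mu))
  let D₂ := mu * b₃ / (2 * Real.pi)
  fin_cases i
  -- The stream functions ψ of the three rows are D₁(x₁²/r² - log r), D₁ x₁x₂/r² and -D₂ log r. The
  -- third-column entries are -D₂ ∂₂ log r, D₂ ∂₁ log r and -2ν D₁ ∂₂ log r.
  · refine integral_div_eq_zero (p := fun x => stress lam mu b₁ b₃ x 0)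
      ((isAxisPotential_cosSq.add (isAxisPotential_logRad.const_smul (-1))).const_smul D₁)
      (-D₂) 1 (fun x => ?_) (fun x => ?_) (fun x => ?_) hg
    · by_cases hr : radSq x = 0
      · obtain ⟨h0, h1⟩ := eq_zero_of_radSq_eq_zero hr
        simp [stress, gradCosSq, gradLogRad, h0, h1]
      · simp [stress, rad_pow_four, gradCosSq, gradLogRad, D₁]
        field_simp
        rw [show radSq x = x 0 ^ 2 + x 1 ^ 2 from rfl]
        ring
    · by_cases hr : radSq x = 0
      · obtain ⟨h0, h1⟩ := eq_zero_of_radSq_eq_zero hr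
        simp [stress, gradCosSq, gradLogRad, h0, h1]
      · simp [stress, rad_pow_four, gradCosSq, gradLogRad, D₁]
        field_simp
        rw [show radSq x = x 0 ^ 2 + x 1 ^ 2 from rfl]
        ring
    · simp [stress, rad_sq, gradLogRad, D₂]
  · refine integral_div_eq_zero (p := fun x => stress lam mu b₁ b₃ x 1)
      (isAxisPotential_cosSin.const_smul D₁) D₂ 0 (fun x => ?_) (fun x => ?_) (fun x => ?_) hg
    · simp [stress, rad_pow_four, gradCosSin, D₁]
    · simp [stress, rad_pow_four, gradCosSin, D₁]
      ring
    · simp [stress, rad_sq, gradLogRad, D₂]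
  · refine integral_div_eq_zero (p := fun x => stress lam mu b₁ b₃ x 2)
      (isAxisPotential_logRad.const_smul (-D₂)) (-2 * poisson lam mu * D₁) 1
      (fun x => ?_) (fun x => ?_) (fun x => ?_) hg
    · simp [stress, rad_sq, gradLogRad, D₂]
    · simp [stress, rad_sq, gradLogRad, D₂]
    · simp [stress, rad_sq, gradLogRad, D₁]

end Dislocation

end

theorem lemma2p2 (lam mu b₁ b₃ : ℝ) (hmu : 0 < mu) (hlam : 0 < 3 * lam + 2 * mu) :
    DifferentiableOn ℝ (Dislocation.displacement lam mu b₁ b₃) Dislocation.closedHalfPlaneᶜ ∧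
    LocallyIntegrable (Dislocation.displacementGrad lam mu b₁ b₃) volume ∧
    LocallyIntegrable (Dislocation.stress lam mu b₁ b₃) volume ∧
    -Dislocation.distDiv (Dislocation.distOf volume (Dislocation.stress lam mu b₁ b₃)) = 0 ∧
    Dislocation.distOf volume (Dislocation.stress lam mu b₁ b₃) =
      Dislocation.distElasticity lam mu (Dislocation.distSym
        (Dislocation.distOf volume (Dislocation.displacementGrad lam mu b₁ b₃))) ∧
    Dislocation.distRot
        (Dislocation.distOf volume (Dislocation.displacementGrad lam mu b₁ b₃)) =
      Dislocation.nyeMeasure !₂[b₁, 0, b₃] := by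
  have hS := Dislocation.locallyIntegrable_stress b₁ b₃ hmu hlam
  have hG := Dislocation.locallyIntegrable_gradDisplacement lam mu b₁ b₃
  have hae := Dislocation.displacementGrad_ae_eq lam mu b₁ b₃
  refine ⟨fun x hx => (Dislocation.differentiableAt_displacement lam mu b₁ b₃
    hx).differentiableWithinAt, hG.congr hae.symm, hS, ?_, ?_, ?_⟩
  · rw [neg_eq_zero]
    exact Dislocation.distDiv_distOf_eq_zero hS fun i g hg =>
      Dislocation.integral_stress_row lam mu b₁ b₃ i hg
  · rw [Dislocation.distOf_congr_ae hG hae]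
    exact Dislocation.distElasticity_distSym_distOf lam mu hG hS
      (Dislocation.stress_eq_hooke b₁ b₃ hmu hlam)
  · rw [Dislocation.distOf_congr_ae hG hae]
    exact Dislocation.distRot_distOf_eq_nyeMeasure
      (Dislocation.hasCirculation_gradDisplacement lam mu b₁ b₃)
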